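/- For real $s>0$ put $\omega_s=\dfrac{2\pi^{s/2}}{\Gamma(s/2)}$. For integers $1\le \ell\le n$ and real $r>0$ define $$ c_r(n,\ell)=\frac{1}{r\,\ell!}\,\omega_n^{-\ell}\,\frac{\omega_{n-\ell+1}\cdots\omega_n}{\omega_1\cdots\omega_\ell}\int_{(\mathbb S^{\ell-1})^\ell}\nabla_\ell(u_1,\ldots,u_\ell)^{\,n-\ell+1}\prod_{j=1}^{\ell}|\langle u_j,e_\ell\rangle|^{r-1}\;\mathcal H^{\ell(\ell-1)}\big(\mathrm d(u_1,\ldots,u_\ell)\big), $$ where $\mathbb S^{\ell-1}$ is the unit sphere of $\mathbb R^\ell$, $e_\ell$ is the last vector of the standard basis of $\mathbb R^\ell$, $\nabla_\ell(u_1,\ldots,u_\ell)$ is the $\ell$-dimensional volume of the parallelepiped spanned by $u_1,\ldots,u_\ell$, and $\mathcal H^{\ell(\ell-1)}$ is the $\ell(\ell-1)$-dimensional Hausdorff measure on $(\mathbb S^{\ell-1})^\ell$, that is, the $\ell$-fold product of the surface measure of $\mathbb S^{\ell-1}$ (for $\ell=1$: the counting measure on $\mathbb S^0=\{-1,1\}$).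 Define also $$ A(n,\ell,r)=\frac{2^\ell}{r\,\ell!}\,\frac{\omega_r\,\omega_{n-\ell+1}}{\omega_\ell\,\omega_{n-\ell+r+1}}\left(\frac{\omega_{n+r}}{\omega_r\,\omega_n}\right)^{\ell}. $$ Then for all integers $1\le\ell\le n$ and all real $r>0$, $$ A(n,\ell,r)\;\le\; c_r(n,\ell)\;\le\;\ell^{\,n-\ell+1}\,A(n,\ell,r). $$ In particular, $c_r(n,1)=A(n,1,r)=r^{-1}$ for all integers $n\ge1$ and all real $r>0$. -/

import Mathlib

open MeasureTheory

noncomputable section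

namespace PoissonPolyhedra

/-- `ω_s = 2 π^{s/2} / Γ(s/2)` for a real parameter `s`; for an integer `s = k ≥ 1` this is
the surface area of the unit sphere of `ℝ^k`. -/
def omega (s : ℝ) : ℝ := 2 * Real.pi ^ (s / 2) / Real.Gamma (s / 2)

/-- The unit sphere `S^{ℓ-1}` of the Euclidean space `ℝ^ℓ`. -/
abbrev USphere (ℓ : ℕ) : Type := Metric.sphere (0 : EuclideanSpace ℝ (Fin ℓ)) 1

/-- The (unnormalized) surface measure on `S^{ℓ-1}`, i.e. the `(ℓ-1)`-dimensional Hausdorff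
measure `H^{ℓ-1}` of the sphere, with total mass `ω_ℓ` for `ℓ ≥ 1`. It is the spherical measure
attached to Lebesgue measure; for `ℓ = 1` it is the counting measure on the two points `±1`. -/
def surfaceMeasure (ℓ : ℕ) : Measure (USphere ℓ) :=
  (volume : Measure (EuclideanSpace ℝ (Fin ℓ))).toSphere

/-- `∇_ℓ(u_1, …, u_ℓ)`: the `ℓ`-dimensional volume of the parallelepiped spanned by
`u_1, …, u_ℓ ∈ ℝ^ℓ`. -/
def nabla {ℓ : ℕ} (u : Fin ℓ → EuclideanSpace ℝ (Fin ℓ)) : ℝ :=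
  (volume (parallelepiped u)).toReal

/-- The last vector `e_ℓ` of the standard basis `e_1, …, e_ℓ` of `ℝ^ℓ` (for `ℓ ≥ 1`); the
one-based index `ℓ` is the zero-based index `i` with `i + 1 = ℓ`. -/
def lastBasisVector (ℓ : ℕ) : EuclideanSpace ℝ (Fin ℓ) :=
  WithLp.toLp 2 (fun i : Fin ℓ => if (i : ℕ) + 1 = ℓ then (1 : ℝ) else 0)

/-- The integral over `(S^{ℓ-1})^ℓ` of `∇_ℓ(u)^{n-ℓ+1} ∏_j |⟨u_j, e_ℓ⟩|^{r-1}` with respect to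
the `ℓ`-fold product of the surface measure (which is `H^{ℓ(ℓ-1)}` on `(S^{ℓ-1})^ℓ`). -/
def sphereIntegral (r : ℝ) (n ℓ : ℕ) : ℝ :=
  ∫ u : Fin ℓ → USphere ℓ,
    nabla (fun j => (u j : EuclideanSpace ℝ (Fin ℓ))) ^ (n - ℓ + 1) *
      ∏ j : Fin ℓ,
        |inner ℝ (u j : EuclideanSpace ℝ (Fin ℓ)) (lastBasisVector ℓ)| ^ (r - 1)
    ∂(Measure.pi fun _ : Fin ℓ => surfaceMeasure ℓ)

/-- The constant `c_r(n, ℓ)`, for `1 ≤ ℓ ≤ n`. -/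
def constC (r : ℝ) (n ℓ : ℕ) : ℝ :=
  1 / (r * (Nat.factorial ℓ : ℝ)) * (omega n ^ ℓ)⁻¹ *
    ((∏ k ∈ Finset.Icc (n - ℓ + 1) n, omega k) / ∏ k ∈ Finset.Icc 1 ℓ, omega k) *
    sphereIntegral r n ℓ

/-- The explicit quantity `A(n, ℓ, r)`, for `1 ≤ ℓ ≤ n`. -/
def boundA (n ℓ : ℕ) (r : ℝ) : ℝ :=
  2 ^ ℓ / (r * (Nat.factorial ℓ : ℝ)) *
    (omega r * omega ((n : ℝ) - ℓ + 1) / (omega ℓ * omega ((n : ℝ) - ℓ + r + 1))) *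
    (omega ((n : ℝ) + r) / (omega r * omega n)) ^ ℓ

end PoissonPolyhedra

end

/-! Write `p = n - ℓ + 1` and `k = ℓ - 1`. The integrand is homogeneous of degree `p + r - 1` in
each vector, so polar coordinates turn the integral over spheres, up to the factor `(Γ((n + r) / 2)
/ 2) ^ ℓ`, into an integral over a square matrix of independent Gaussian entries
(`lintegral_sphereIntegrand`). The weights involve only the last column. Laplace expansion along it
(`gaussIntegral_eq`) makes the determinant a linear form in that column, with cofactors depending
only on the other columns.

For fixed cofactors, flipping the sign of one entry and averaging isolates a single term from below
(`le_lintegral_abs_sum_pow`). The power mean inequality bounds the form from above by all terms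
(`lintegral_abs_sum_pow_le`). All cofactors have the same `p`-th moment, so the two bounds differ
exactly by `ℓ ^ (p - 1) * ℓ = ℓ ^ p`.

The cofactor moment is that of a smaller Gaussian determinant, computed row by row from rotation
invariance (`detMoment_succ`). Rewriting Gamma quotients through `omega` identifies the common bound
with `boundA` (`boundA_eq`). -/

noncomputable section

namespace PoissonPolyhedra

/-! ### Integrals and densities on finite products -/

section PiTools

variable {X : Type*} [MeasurableSpace X]

theorem lintegral_pi_prod : ∀ {n : ℕ} (μ : Fin n → Measure X) [∀ i, SigmaFinite (μ i)]
    (f : Fin n → X → ENNReal), (∀ i, Measurable (f i)) →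
    ∫⁻ x, ∏ i, f i (x i) ∂(Measure.pi μ) = ∏ i, ∫⁻ x, f i x ∂(μ i)
  | 0, μ, _, f, _ => by simp
  | n + 1, μ, _, f, hf => by
    have hm := (measurePreserving_piFinSuccAbove μ 0).symm
    rw [← hm.lintegral_comp (by fun_prop), Fin.prod_univ_succ]
    simp only [MeasurableEquiv.piFinSuccAbove_symm_apply, Fin.insertNthEquiv_apply,
      Fin.insertNth_zero, Fin.prod_univ_succ, Fin.cons_zero, Fin.cons_succ, cast_eq]
    rw [lintegral_prod_mul (f := f 0)
      (g := fun y : Fin n → X => ∏ i : Fin n, f i.succ (y i)) (hf 0).aemeasurable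
      (Finset.measurable_prod _ fun i _ =>
        (hf i.succ).comp (measurable_pi_apply i)).aemeasurable]
    simp only [Fin.succAbove_zero]
    rw [lintegral_pi_prod (fun i => μ i.succ) (fun i => f i.succ) (fun i => hf _)]

theorem pi_withDensity {n : ℕ} (μ : Fin n → Measure X) [∀ i, SigmaFinite (μ i)]
    (f : Fin n → X → ENNReal) (hf : ∀ i, Measurable (f i))
    [∀ i, SigmaFinite ((μ i).withDensity (f i))] :
    Measure.pi (fun i => (μ i).withDensity (f i)) =
      (Measure.pi μ).withDensity (fun x => ∏ i, f i (x i)) := by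
  refine Measure.pi_eq fun s hs => ?_
  rw [withDensity_apply _ (MeasurableSet.univ_pi hs),
    ← lintegral_indicator (MeasurableSet.univ_pi hs)]
  have : ∀ x : Fin n → X, (Set.univ.pi s).indicator (fun x => ∏ i, f i (x i)) x
      = ∏ i, (s i).indicator (f i) (x i) := by
    intro x
    by_cases hx : x ∈ Set.univ.pi s
    · rw [Set.indicator_of_mem hx]
      exact Finset.prod_congr rfl fun i _ =>
        (Set.indicator_of_mem (hx i (Set.mem_univ i)) _).symm
    · rw [Set.indicator_of_notMem hx]
      simp only [Set.mem_pi, Set.mem_univ, true_implies, not_forall] at hx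
      obtain ⟨i, hi⟩ := hx
      exact (Finset.prod_eq_zero (Finset.mem_univ i) (Set.indicator_of_notMem hi _)).symm
  simp_rw [this]
  rw [lintegral_pi_prod μ _ fun i => (hf i).indicator (hs i)]
  refine Finset.prod_congr rfl fun i _ => ?_
  rw [withDensity_apply _ (hs i), lintegral_indicator (hs i)]

end PiTools

/-! ### The Gaussian measure and its one-dimensional moments -/

/-- The unnormalized Gaussian measure `exp (-‖x‖²) dx`. -/
def gauss (E : Type*) [NormedAddCommGroup E] [MeasureSpace E] : Measure E :=
  (volume : Measure E).withDensity fun x => ENNReal.ofReal (Real.exp (-‖x‖ ^ 2))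

theorem measurable_gaussDensity (E : Type*) [NormedAddCommGroup E] [MeasurableSpace E]
    [OpensMeasurableSpace E] :
    Measurable fun x : E => ENNReal.ofReal (Real.exp (-‖x‖ ^ 2)) := by fun_prop

instance (E : Type*) [NormedAddCommGroup E] [MeasureSpace E]
    [SigmaFinite (volume : Measure E)] : SigmaFinite (gauss E) := by
  unfold gauss; infer_instance

/-- Since `exp (-‖x‖²)` factors over coordinates, one measure has both independent coordinates (used
for matrix entries) and rotation invariance (used for determinant moments). -/
theorem map_toLp_pi_gauss (m : ℕ) :
    (Measure.pi fun _ : Fin m => gauss ℝ).map (WithLp.toLp 2) =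
      gauss (EuclideanSpace ℝ (Fin m)) := by
  have h := PiLp.volume_preserving_toLp (Fin m)
  unfold gauss
  have hp := pi_withDensity (fun _ : Fin m => (volume : Measure ℝ))
    (fun _ x => ENNReal.ofReal (Real.exp (-‖x‖ ^ 2))) (fun _ => measurable_gaussDensity ℝ)
  rw [hp]
  ext s hs
  rw [Measure.map_apply h.measurable hs, withDensity_apply _ (h.measurable hs),
    withDensity_apply _ hs, ← h.setLIntegral_comp_preimage hs (measurable_gaussDensity _)]
  rw [← volume_pi]
  congr 1
  ext x
  rw [← ENNReal.ofReal_prod_of_nonneg (fun _ _ => (Real.exp_pos _).le), ← Real.exp_sum,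
    EuclideanSpace.norm_sq_eq]
  simp

theorem lintegral_Ioi_rpow_mul_exp_neg_sq {s : ℝ} (hs : 0 < s) :
    ∫⁻ x in Set.Ioi (0 : ℝ), ENNReal.ofReal (x ^ (s - 1) * Real.exp (-x ^ 2)) =
      ENNReal.ofReal (Real.Gamma (s / 2) / 2) := by
  have h1 := integral_rpow_mul_exp_neg_rpow (p := 2) (q := s - 1) (by norm_num) (by linarith)
  have h2 := integrableOn_rpow_mul_exp_neg_rpow (p := 2) (s := s - 1) (by linarith) (by norm_num)
  simp only [Real.rpow_two, sub_add_cancel] at h1 h2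
  rw [← ofReal_integral_eq_lintegral_ofReal h2, h1]
  · congr 1; ring
  · filter_upwards [ae_restrict_mem measurableSet_Ioi] with x hx
    have : (0 : ℝ) < x := hx
    simp only [Pi.zero_apply]; positivity

theorem lintegral_even (f : ℝ → ENNReal) (hf : ∀ x, f (-x) = f x) :
    ∫⁻ x, f x = 2 * ∫⁻ x in Set.Ioi (0 : ℝ), f x := by
  rw [← lintegral_add_compl f (measurableSet_Ioi (a := (0 : ℝ))), Set.compl_Ioi, two_mul]
  congr 1
  rw [setLIntegral_congr (Iio_ae_eq_Iic (a := (0 : ℝ))).symm]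
  have h := (Measure.measurePreserving_neg (volume : Measure ℝ)).setLIntegral_comp_preimage_emb
    (MeasurableEquiv.neg ℝ).measurableEmbedding f (Set.Ioi 0)
  simpa [hf] using h

theorem lintegral_gauss {E : Type*} [NormedAddCommGroup E] [MeasureSpace E]
    [OpensMeasurableSpace E] {g : E → ENNReal} (hg : Measurable g) :
    ∫⁻ x, g x ∂(gauss E) = ∫⁻ x, ENNReal.ofReal (Real.exp (-‖x‖ ^ 2)) * g x := by
  rw [gauss, lintegral_withDensity_eq_lintegral_mul _ (measurable_gaussDensity E) hg]
  rfl

theorem lintegral_abs_rpow_gauss {s : ℝ} (hs : 0 < s) :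
    ∫⁻ x, ENNReal.ofReal (|x| ^ (s - 1)) ∂(gauss ℝ) = ENNReal.ofReal (Real.Gamma (s / 2)) := by
  rw [lintegral_gauss (by fun_prop), lintegral_even _ (by simp)]
  have : ∀ x ∈ Set.Ioi (0 : ℝ), ENNReal.ofReal (Real.exp (-‖x‖ ^ 2)) * ENNReal.ofReal (|x| ^ (s - 1))
      = ENNReal.ofReal (x ^ (s - 1) * Real.exp (-x ^ 2)) := by
    intro x hx
    rw [← ENNReal.ofReal_mul (Real.exp_pos _).le, Real.norm_eq_abs, abs_of_pos hx, mul_comm]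
  rw [setLIntegral_congr_fun measurableSet_Ioi this, lintegral_Ioi_rpow_mul_exp_neg_sq hs,
    ENNReal.ofReal_div_of_pos two_pos, ENNReal.ofReal_ofNat, ENNReal.mul_div_cancel] <;> simp

/-! ### Polar coordinates: from spheres to Gaussian vectors -/

theorem lintegral_eq_lintegral_sphere_prod {E : Type*} [NormedAddCommGroup E] [NormedSpace ℝ E]
    [MeasurableSpace E] [BorelSpace E] [FiniteDimensional ℝ E] [Nontrivial E]
    (μ : Measure E) [μ.IsAddHaarMeasure] (f : E → ENNReal) (hf : Measurable f) :
    ∫⁻ x, f x ∂μ = ∫⁻ u : Metric.sphere (0 : E) 1, (∫⁻ ρ in Set.Ioi (0 : ℝ),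
      ENNReal.ofReal (ρ ^ (Module.finrank ℝ E - 1)) * f (ρ • (u : E))) ∂μ.toSphere := by
  have h0 : ∫⁻ x, f x ∂μ = ∫⁻ x : ({0}ᶜ : Set E), f x ∂(μ.comap (↑)) := by
    rw [lintegral_subtype_comap (measurableSet_singleton _).compl, restrict_compl_singleton]
  have hmeas : Measurable fun y : Metric.sphere (0 : E) 1 × Set.Ioi (0 : ℝ) =>
      f ((y.2 : ℝ) • (y.1 : E)) := by fun_prop
  have h1 := μ.measurePreserving_homeomorphUnitSphereProd.lintegral_comp hmeas
  rw [h0]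
  have h2 : ∀ x : ({0}ᶜ : Set E),
      f ((((homeomorphUnitSphereProd E) x).2 : ℝ) • (((homeomorphUnitSphereProd E) x).1 : E))
        = f x := by
    intro x
    congr 1
    have hx : ‖(x : E)‖ ≠ 0 := norm_ne_zero_iff.mpr x.2
    simp [smul_smul, hx]
  simp only [h2] at h1
  rw [h1, lintegral_prod _ hmeas.aemeasurable]
  refine lintegral_congr fun u => ?_
  have hfu : Measurable fun ρ : Set.Ioi (0 : ℝ) => f ((ρ : ℝ) • (u : E)) := by fun_prop
  refine (lintegral_withDensity_eq_lintegral_mul _ (by fun_prop) hfu).trans ?_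
  exact lintegral_subtype_comap (μ := volume) measurableSet_Ioi
    fun ρ : ℝ => ENNReal.ofReal (ρ ^ (Module.finrank ℝ E - 1)) * f (ρ • (u : E))

/-- The radial integral of `ρ ^ (m - 1 + d) * exp (-ρ²)` splits off and produces the Gamma factor.
Homogeneity is only asked along open rays, so the value of `g` at the origin is irrelevant. -/
theorem lintegral_gauss_of_homogeneous {m : ℕ} (hm : 0 < m) {d : ℝ} (hd : 0 < d + m)
    (g : EuclideanSpace ℝ (Fin m) → ENNReal) (hg : Measurable g)
    (hom : ∀ c : ℝ, 0 < c → ∀ u : USphere m,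
      g (c • (u : EuclideanSpace ℝ (Fin m))) = ENNReal.ofReal (c ^ d) * g u) :
    ∫⁻ x, g x ∂(gauss (EuclideanSpace ℝ (Fin m))) =
      ENNReal.ofReal (Real.Gamma ((d + m) / 2) / 2) * ∫⁻ u, g u ∂(surfaceMeasure m) := by
  have : Nonempty (Fin m) := ⟨⟨0, hm⟩⟩
  rw [lintegral_gauss hg, lintegral_eq_lintegral_sphere_prod volume _ (by fun_prop),
    surfaceMeasure, ← lintegral_const_mul' _ _ ENNReal.ofReal_ne_top]
  refine lintegral_congr fun u => ?_
  rw [← lintegral_Ioi_rpow_mul_exp_neg_sq hd, ← lintegral_mul_const _ (by fun_prop)]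
  refine setLIntegral_congr_fun measurableSet_Ioi fun ρ hρ => ?_
  have hρ' : (0 : ℝ) < ρ := hρ
  have hu : ‖(u : EuclideanSpace ℝ (Fin m))‖ = 1 := by simp
  simp only [finrank_euclideanSpace, Fintype.card_fin]
  rw [hom ρ hρ' u, norm_smul, hu, mul_one, Real.norm_eq_abs, sq_abs, ← mul_assoc, ← mul_assoc,
    ← ENNReal.ofReal_mul (by positivity), ← ENNReal.ofReal_mul (by positivity)]
  congr 2
  have : ρ ^ (d + m - 1) = ρ ^ (m - 1) * ρ ^ d := by
    rw [← Real.rpow_natCast, ← Real.rpow_add hρ', Nat.cast_pred hm]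
    congr 1; ring
  rw [this]; ring

/-- The normalized radial weight whose Gaussian image on the sphere is the surface measure. -/
def radialDensity (m : ℕ) (d : ℝ) (x : EuclideanSpace ℝ (Fin m)) : ENNReal :=
  ENNReal.ofReal ((Real.Gamma ((d + m) / 2) / 2)⁻¹ * ‖x‖ ^ d)

theorem measurable_radialDensity (m : ℕ) (d : ℝ) : Measurable (radialDensity m d) := by
  unfold radialDensity; fun_prop

instance (m : ℕ) (d : ℝ) :
    SigmaFinite ((gauss (EuclideanSpace ℝ (Fin m))).withDensity (radialDensity m d)) := by
  unfold radialDensity; infer_instance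

open Classical in
/-- The direction `x / ‖x‖`, with value `u₀` at the origin. -/
def direction {m : ℕ} (u₀ : USphere m) (x : EuclideanSpace ℝ (Fin m)) : USphere m :=
  ⟨if x = 0 then u₀ else ‖x‖⁻¹ • x, by
    split_ifs with h
    · exact u₀.2
    · simp [norm_smul, norm_ne_zero_iff.mpr h]⟩

theorem measurable_direction {m : ℕ} (u₀ : USphere m) : Measurable (direction u₀) := by
  unfold direction
  exact (Measurable.ite (measurableSet_singleton 0) measurable_const (by fun_prop)).subtype_mk

theorem direction_smul {m : ℕ} (u₀ u : USphere m) {c : ℝ} (hc : 0 < c) :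
    direction u₀ (c • (u : EuclideanSpace ℝ (Fin m))) = u := by
  have hu : ‖(u : EuclideanSpace ℝ (Fin m))‖ = 1 := by simp
  have hu0 : (u : EuclideanSpace ℝ (Fin m)) ≠ 0 := fun h => by simp [h] at hu
  have : c • (u : EuclideanSpace ℝ (Fin m)) ≠ 0 := smul_ne_zero hc.ne' hu0
  ext1
  simp only [direction, if_neg this, norm_smul, hu, Real.norm_eq_abs, abs_of_pos hc, mul_one, smul_smul,
    inv_mul_cancel₀ hc.ne', one_smul]

theorem norm_smul_direction {m : ℕ} (u₀ : USphere m) {x : EuclideanSpace ℝ (Fin m)}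
    (hx : x ≠ 0) : ‖x‖ • (direction u₀ x : EuclideanSpace ℝ (Fin m)) = x := by
  simp [direction, hx, smul_smul, norm_ne_zero_iff.mpr hx]

/-- The radial weight restricted to a cone of directions is homogeneous of degree `d`, so its
Gaussian integral reduces to the sphere. With surface measure as a pushforward, the passage to a
product of spheres is a single change of variables. -/
theorem map_direction_radial {m : ℕ} (hm : 0 < m) {d : ℝ} (hd : 0 < d + m) (u₀ : USphere m) :
    ((gauss (EuclideanSpace ℝ (Fin m))).withDensity (radialDensity m d)).map (direction u₀) =
      surfaceMeasure m := by
  ext s hs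
  have hd2 : 0 < Real.Gamma ((d + m) / 2) / 2 := by
    have := Real.Gamma_pos_of_pos (half_pos hd); positivity
  have hs' := measurable_direction u₀ hs
  rw [Measure.map_apply (measurable_direction u₀) hs, withDensity_apply _ hs',
    ← lintegral_indicator hs', lintegral_gauss_of_homogeneous hm hd _
      ((measurable_radialDensity m d).indicator hs')]
  · have : ∀ u : USphere m, (direction u₀ ⁻¹' s).indicator (radialDensity m d)
        (u : EuclideanSpace ℝ (Fin m)) =
        ENNReal.ofReal (Real.Gamma ((d + m) / 2) / 2)⁻¹ * s.indicator 1 u := by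
      intro u
      have hu := direction_smul u₀ u one_pos
      rw [one_smul] at hu
      by_cases h : u ∈ s
      · rw [Set.indicator_of_mem (by simpa [hu] using h), Set.indicator_of_mem h]
        simp [radialDensity]
      · rw [Set.indicator_of_notMem (by simpa [hu] using h), Set.indicator_of_notMem h, mul_zero]
    simp_rw [this]
    rw [lintegral_const_mul' _ _ ENNReal.ofReal_ne_top, lintegral_indicator_one hs, ← mul_assoc,
      ← ENNReal.ofReal_mul hd2.le, mul_inv_cancel₀ hd2.ne', ENNReal.ofReal_one, one_mul]
  · intro c hc u
    have hu := direction_smul u₀ u one_pos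
    rw [one_smul] at hu
    by_cases h : u ∈ s
    · rw [Set.indicator_of_mem (by simpa [direction_smul u₀ u hc] using h),
        Set.indicator_of_mem (by simpa [hu] using h)]
      unfold radialDensity
      rw [← ENNReal.ofReal_mul (by positivity)]
      simp only [norm_smul, norm_eq_of_mem_sphere, Real.norm_eq_abs, abs_of_pos hc, mul_one,
        Real.one_rpow]
      rw [mul_comm]
    · rw [Set.indicator_of_notMem (by simpa [direction_smul u₀ u hc] using h),
        Set.indicator_of_notMem (by simpa [hu] using h), mul_zero]

/-- Passing from a product of spheres to a product of Gaussian measures, for a function that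
is homogeneous of degree `d` in each variable. -/
theorem lintegral_pi_gauss_of_homogeneous {m k : ℕ} (hm : 0 < m) {d : ℝ} (hd : 0 < d + m)
    (F : (Fin k → EuclideanSpace ℝ (Fin m)) → ENNReal) (hF : Measurable F)
    (hom : ∀ (c : Fin k → ℝ) (x : Fin k → EuclideanSpace ℝ (Fin m)), (∀ j, 0 < c j) →
      F (fun j => c j • x j) = (∏ j, ENNReal.ofReal (c j ^ d)) * F x) :
    ∫⁻ x, F x ∂(Measure.pi fun _ : Fin k => gauss (EuclideanSpace ℝ (Fin m))) =
      ENNReal.ofReal (Real.Gamma ((d + m) / 2) / 2) ^ k *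
        ∫⁻ u : Fin k → USphere m, F (fun j => (u j : EuclideanSpace ℝ (Fin m)))
          ∂(Measure.pi fun _ : Fin k => surfaceMeasure m) := by
  have : Nonempty (Fin m) := ⟨⟨0, hm⟩⟩
  have hd2 : 0 < Real.Gamma ((d + m) / 2) / 2 := by
    have := Real.Gamma_pos_of_pos (half_pos hd); positivity
  obtain ⟨v, hv⟩ := exists_norm_eq (EuclideanSpace ℝ (Fin m)) zero_le_one
  let u₀ : USphere m := ⟨v, by simp [hv]⟩
  have hmap := map_direction_radial hm hd u₀
  have hpi : (Measure.pi fun _ : Fin k => surfaceMeasure m) =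
      ((Measure.pi fun _ : Fin k => gauss (EuclideanSpace ℝ (Fin m))).withDensity
        (fun x => ∏ j, radialDensity m d (x j))).map (fun x j => direction u₀ (x j)) := by
    rw [← pi_withDensity _ _ (fun _ => measurable_radialDensity m d), ← hmap]
    have : SigmaFinite (((gauss (EuclideanSpace ℝ (Fin m))).withDensity
      (radialDensity m d)).map (direction u₀)) := by rw [hmap]; unfold surfaceMeasure; infer_instance
    exact (Measure.pi_map_pi fun _ => (measurable_direction u₀).aemeasurable).symm
  have hdir := measurable_direction u₀
  have hrad := measurable_radialDensity m d
  have hdirpi : Measurable fun (x : Fin k → EuclideanSpace ℝ (Fin m)) (j : Fin k) =>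
      direction u₀ (x j) :=
    measurable_pi_lambda _ fun j => hdir.comp (measurable_pi_apply j)
  have hFS : Measurable fun u : Fin k → USphere m =>
      F fun j => (u j : EuclideanSpace ℝ (Fin m)) := by fun_prop
  have hFd : Measurable fun x : Fin k → EuclideanSpace ℝ (Fin m) =>
      F fun j => (direction u₀ (x j) : EuclideanSpace ℝ (Fin m)) := hFS.comp hdirpi
  rw [hpi, lintegral_map hFS hdirpi]
  beta_reduce
  rw [lintegral_withDensity_eq_lintegral_mul _ (by fun_prop) hFd,
    ← lintegral_const_mul' _ _ (by finiteness)]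
  have hne : ∀ j : Fin k, ∀ᵐ x ∂(Measure.pi fun _ : Fin k => gauss (EuclideanSpace ℝ (Fin m))),
      x j ≠ 0 := by
    intro j
    have h0 : ∀ᵐ y ∂(gauss (EuclideanSpace ℝ (Fin m))), y ≠ 0 :=
      (withDensity_absolutelyContinuous _ _).ae_le (compl_mem_ae_iff.mpr (measure_singleton 0))
    exact (Measure.tendsto_eval_ae_ae (μ := fun _ : Fin k => gauss (EuclideanSpace ℝ (Fin m)))
      (i := j)).eventually h0
  refine lintegral_congr_ae ?_
  filter_upwards [ae_all_iff.mpr hne] with x hx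
  -- Scaling each direction back by its norm recovers `x`; the factors `‖x j‖ ^ d` are the radial
  -- densities up to the Gamma constant.
  have h1 := hom (fun j => ‖x j‖) (fun j => (direction u₀ (x j) : EuclideanSpace ℝ (Fin m)))
    fun j => norm_pos_iff.mpr (hx j)
  simp only [norm_smul_direction u₀ (hx _)] at h1
  rw [h1, Pi.mul_apply, ← mul_assoc]
  congr 1
  have h2 : ∀ j, ENNReal.ofReal (Real.Gamma ((d + m) / 2) / 2) * radialDensity m d (x j) =
      ENNReal.ofReal (‖x j‖ ^ d) := by
    intro j
    rw [radialDensity, ← ENNReal.ofReal_mul hd2.le, ← mul_assoc, mul_inv_cancel₀ hd2.ne', one_mul]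
  simp only [← h2, Finset.prod_mul_distrib, Finset.prod_const, Finset.card_univ, Fintype.card_fin]

/-! ### The parallelepiped volume and its invariances -/

theorem nabla_eq_abs_det {m : ℕ} (u : Fin m → EuclideanSpace ℝ (Fin m)) :
    nabla u = |(Matrix.of fun i j => u i j).det| := by
  have h := Measure.addHaar_parallelepiped (EuclideanSpace.basisFun (Fin m) ℝ).toBasis u
  rw [OrthonormalBasis.addHaar_eq_volume] at h
  rw [nabla, h, ENNReal.toReal_ofReal (abs_nonneg _), Module.Basis.det_apply,
    ← Matrix.det_transpose]
  rfl

theorem nabla_nonneg {m : ℕ} (u : Fin m → EuclideanSpace ℝ (Fin m)) : 0 ≤ nabla u :=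
  ENNReal.toReal_nonneg

theorem measurable_nabla {m : ℕ} :
    Measurable (nabla : (Fin m → EuclideanSpace ℝ (Fin m)) → ℝ) := by
  have : (nabla : (Fin m → EuclideanSpace ℝ (Fin m)) → ℝ) =
      fun u => |(Matrix.of fun i j => u i j).det| := funext nabla_eq_abs_det
  rw [this]
  simp only [Matrix.det_apply, Matrix.of_apply]
  fun_prop

theorem nabla_smul {m : ℕ} (c : Fin m → ℝ) (u : Fin m → EuclideanSpace ℝ (Fin m)) :
    nabla (fun j => c j • u j) = (∏ j, |c j|) * nabla u := by
  rw [nabla_eq_abs_det, nabla_eq_abs_det, ← Finset.abs_prod, ← abs_mul,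
    ← Matrix.det_mul_column]
  rfl

theorem nabla_isometry {m : ℕ} (R : EuclideanSpace ℝ (Fin m) ≃ₗᵢ[ℝ] EuclideanSpace ℝ (Fin m))
    (u : Fin m → EuclideanSpace ℝ (Fin m)) : nabla (fun j => R (u j)) = nabla u := by
  unfold nabla
  have h : parallelepiped (fun j => R (u j)) = R '' parallelepiped u :=
    (image_parallelepiped R.toLinearEquiv.toLinearMap u).symm
  have h2 := R.symm.measurePreserving.measure_preimage_emb
    R.symm.toMeasurableEquiv.measurableEmbedding (parallelepiped u)
  rw [h, ← h2]
  congr 2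
  exact R.toEquiv.image_eq_preimage_symm _

theorem measurePreserving_gauss_isometry {E : Type*} [NormedAddCommGroup E]
    [InnerProductSpace ℝ E] [FiniteDimensional ℝ E] [MeasurableSpace E] [BorelSpace E]
    (R : E ≃ₗᵢ[ℝ] E) : MeasurePreserving R (gauss E) (gauss E) := by
  refine ⟨R.continuous.measurable, ?_⟩
  ext s hs
  have hs' := R.continuous.measurable hs
  rw [Measure.map_apply R.continuous.measurable hs, gauss, withDensity_apply _ hs',
    withDensity_apply _ hs,
    ← R.measurePreserving.setLIntegral_comp_preimage hs (measurable_gaussDensity E)]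
  simp

/-! ### Gaussian matrices: splitting off a row or a column -/

/-- The unnormalized Gaussian measure on `k × l` matrices. -/
def gaussMatrix (k l : ℕ) : Measure (Fin k → Fin l → ℝ) :=
  Measure.pi fun _ => Measure.pi fun _ => gauss ℝ

instance (k l : ℕ) : SigmaFinite (gaussMatrix k l) := by
  unfold gaussMatrix; infer_instance

theorem lintegral_pi_gauss_eq_gaussMatrix {k m : ℕ}
    (F : (Fin k → EuclideanSpace ℝ (Fin m)) → ENNReal) (hF : Measurable F) :
    ∫⁻ u, F u ∂(Measure.pi fun _ : Fin k => gauss (EuclideanSpace ℝ (Fin m))) =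
      ∫⁻ M, F (fun j => WithLp.toLp 2 (M j)) ∂(gaussMatrix k m) := by
  have h : MeasurePreserving (WithLp.toLp 2 : (Fin m → ℝ) → EuclideanSpace ℝ (Fin m))
      (Measure.pi fun _ => gauss ℝ) (gauss _) :=
    ⟨(PiLp.volume_preserving_toLp (Fin m)).measurable, map_toLp_pi_gauss m⟩
  exact ((measurePreserving_pi _ _ fun _ : Fin k => h).lintegral_comp hF).symm

theorem lintegral_gaussMatrix_row {k l : ℕ} (i : Fin (k + 1))
    (F : (Fin (k + 1) → Fin l → ℝ) → ENNReal) (hF : Measurable F) :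
    ∫⁻ M, F M ∂(gaussMatrix (k + 1) l) =
      ∫⁻ N, ∫⁻ x, F (i.insertNth x N) ∂(Measure.pi fun _ => gauss ℝ) ∂(gaussMatrix k l) := by
  have h := (measurePreserving_piFinSuccAbove
    (fun _ : Fin (k + 1) => Measure.pi fun _ : Fin l => gauss ℝ) i).symm
  exact (h.lintegral_comp hF).symm.trans (lintegral_prod_symm' _ (hF.comp h.measurable))

theorem lintegral_gaussMatrix_col {k l : ℕ} (i : Fin (l + 1))
    (F : (Fin k → Fin (l + 1) → ℝ) → ENNReal) (hF : Measurable F) :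
    ∫⁻ M, F M ∂(gaussMatrix k (l + 1)) =
      ∫⁻ N, ∫⁻ h, F (fun a => i.insertNth (h a) (N a)) ∂(Measure.pi fun _ => gauss ℝ)
        ∂(gaussMatrix k l) := by
  have h := measurePreserving_pi (fun _ : Fin k => (gauss ℝ).prod
      (Measure.pi fun _ : Fin l => gauss ℝ)) _
    fun _ : Fin k => (measurePreserving_piFinSuccAbove (fun _ : Fin (l + 1) => gauss ℝ) i).symm
  have h' := (measurePreserving_arrowProdEquivProdArrow ℝ (Fin l → ℝ) (Fin k)
    (fun _ => gauss ℝ) (fun _ => Measure.pi fun _ : Fin l => gauss ℝ)).symm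
  exact ((h.comp h').lintegral_comp hF).symm.trans
    (lintegral_prod_symm' _ (hF.comp (h.comp h').measurable))

theorem gauss_real_univ : gauss ℝ Set.univ = ENNReal.ofReal √Real.pi := by
  have := lintegral_abs_rpow_gauss one_pos
  rw [Real.Gamma_one_half_eq] at this
  simpa using this

theorem pi_gauss_univ (k : ℕ) :
    (Measure.pi fun _ : Fin k => gauss ℝ) Set.univ = ENNReal.ofReal √Real.pi ^ k := by
  simp [Measure.pi_univ, gauss_real_univ]

theorem gauss_euclidean_univ (m : ℕ) :
    gauss (EuclideanSpace ℝ (Fin m)) Set.univ = ENNReal.ofReal √Real.pi ^ m := by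
  rw [← map_toLp_pi_gauss, Measure.map_apply (PiLp.volume_preserving_toLp (Fin m)).measurable
    MeasurableSet.univ, Set.preimage_univ, pi_gauss_univ]

theorem surfaceMeasure_univ {m : ℕ} (hm : 0 < m) :
    ENNReal.ofReal (Real.Gamma ((m : ℝ) / 2) / 2) * surfaceMeasure m Set.univ =
      ENNReal.ofReal √Real.pi ^ m := by
  have h := lintegral_gauss_of_homogeneous hm (d := 0) (by positivity) (fun _ => 1)
    measurable_const (by simp)
  simpa [gauss_euclidean_univ] using h.symm

theorem lintegral_norm_pow_gauss {m : ℕ} (hm : 0 < m) (p : ℕ) :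
    ∫⁻ x, ENNReal.ofReal (‖x‖ ^ p) ∂(gauss (EuclideanSpace ℝ (Fin m))) =
      ENNReal.ofReal (√Real.pi ^ m * Real.Gamma ((p + m : ℝ) / 2) / Real.Gamma ((m : ℝ) / 2)) := by
  have hm' : (0 : ℝ) < m := Nat.cast_pos.mpr hm
  have h1 : 0 < Real.Gamma ((m : ℝ) / 2) := Real.Gamma_pos_of_pos (by positivity)
  have h2 : 0 < Real.Gamma ((p + m : ℝ) / 2) := Real.Gamma_pos_of_pos (by positivity)
  have h := lintegral_gauss_of_homogeneous hm (d := (p : ℝ)) (by positivity)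
    (fun x => ENNReal.ofReal (‖x‖ ^ p)) (by fun_prop) (by
      intro c hc u
      simp [norm_smul, abs_of_pos hc])
  rw [h]
  have h3 : Real.Gamma ((p + m : ℝ) / 2) / 2 =
      Real.Gamma ((p + m : ℝ) / 2) / Real.Gamma ((m : ℝ) / 2) * (Real.Gamma ((m : ℝ) / 2) / 2) := by
    field_simp
  simp only [norm_eq_of_mem_sphere, one_pow, ENNReal.ofReal_one, lintegral_const, one_mul]
  rw [h3, ENNReal.ofReal_mul (by positivity), mul_assoc, surfaceMeasure_univ hm,
    ← ENNReal.ofReal_pow (by positivity), ← ENNReal.ofReal_mul (by positivity)]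
  congr 1; ring

/-! ### Moments of Gaussian determinants -/

/-- The `p`-th absolute moment of the determinant of a `k × k` Gaussian matrix. -/
def detMoment (p k : ℕ) : ENNReal :=
  ∫⁻ M, ENNReal.ofReal (|(Matrix.of M).det| ^ p) ∂(gaussMatrix k k)

theorem measurable_abs_det_pow {α : Type*} [MeasurableSpace α] {k p : ℕ}
    {M : α → Fin k → Fin k → ℝ} (hM : Measurable M) :
    Measurable fun a => ENNReal.ofReal (|(Matrix.of (M a)).det| ^ p) := by
  simp only [Matrix.det_apply, Matrix.of_apply]
  fun_prop

theorem detMoment_zero (p : ℕ) : detMoment p 0 = 1 := by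
  simp [detMoment, gaussMatrix]

/-- The deleted row contributes only its total mass, one `√π` for each of its `k` entries. -/
theorem lintegral_det_delete_row (p : ℕ) {k : ℕ} (i : Fin (k + 1)) :
    ∫⁻ N, ENNReal.ofReal (|(Matrix.of fun a => N (i.succAbove a)).det| ^ p)
      ∂(gaussMatrix (k + 1) k) = ENNReal.ofReal √Real.pi ^ k * detMoment p k := by
  rw [lintegral_gaussMatrix_row i _ (measurable_abs_det_pow (by fun_prop))]
  simp only [Fin.insertNth_apply_succAbove, lintegral_const, pi_gauss_univ]
  rw [lintegral_mul_const _ (measurable_abs_det_pow (by fun_prop)), mul_comm]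
  rfl

theorem lintegral_det_delete_col (p : ℕ) {k : ℕ} (i : Fin (k + 1)) :
    ∫⁻ N, ENNReal.ofReal (|(Matrix.of fun a b => N a (i.succAbove b)).det| ^ p)
      ∂(gaussMatrix k (k + 1)) = ENNReal.ofReal √Real.pi ^ k * detMoment p k := by
  rw [lintegral_gaussMatrix_col i _ (measurable_abs_det_pow (by fun_prop))]
  simp only [Fin.insertNth_apply_succAbove, lintegral_const, pi_gauss_univ]
  rw [lintegral_mul_const _ (measurable_abs_det_pow (by fun_prop)), mul_comm]
  rfl

theorem detMoment_eq_lintegral_nabla (p k : ℕ) :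
    detMoment p k = ∫⁻ u, ENNReal.ofReal (nabla u ^ p)
      ∂(Measure.pi fun _ : Fin k => gauss (EuclideanSpace ℝ (Fin k))) := by
  have := measurable_nabla (m := k)
  rw [lintegral_pi_gauss_eq_gaussMatrix _ (by fun_prop)]
  simp only [nabla_eq_abs_det]
  rfl

/-- The `p`-th moment of the volume spanned by a fixed vector and `k` Gaussian vectors. -/
def pinnedMoment (p k : ℕ) (x : EuclideanSpace ℝ (Fin (k + 1))) : ENNReal :=
  ∫⁻ N, ENNReal.ofReal (nabla (Fin.cons x N : Fin (k + 1) → EuclideanSpace ℝ (Fin (k + 1))) ^ p)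
    ∂(Measure.pi fun _ : Fin k => gauss (EuclideanSpace ℝ (Fin (k + 1))))

theorem pinnedMoment_isometry (p k : ℕ)
    (R : EuclideanSpace ℝ (Fin (k + 1)) ≃ₗᵢ[ℝ] EuclideanSpace ℝ (Fin (k + 1)))
    (x : EuclideanSpace ℝ (Fin (k + 1))) : pinnedMoment p k (R x) = pinnedMoment p k x := by
  have hn := measurable_nabla (m := k + 1)
  unfold pinnedMoment
  have h := measurePreserving_pi _ _ fun _ : Fin k => measurePreserving_gauss_isometry R
  rw [← h.lintegral_comp (by fun_prop)]
  refine lintegral_congr fun N => ?_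
  rw [← nabla_isometry R (Fin.cons x N)]
  congr 3
  ext1 j
  refine Fin.cases ?_ (fun j => ?_) j <;> simp

theorem pinnedMoment_smul (p k : ℕ) (c : ℝ) (x : EuclideanSpace ℝ (Fin (k + 1))) :
    pinnedMoment p k (c • x) = ENNReal.ofReal (|c| ^ p) * pinnedMoment p k x := by
  unfold pinnedMoment
  rw [← lintegral_const_mul' _ _ ENNReal.ofReal_ne_top]
  refine lintegral_congr fun N => ?_
  rw [← ENNReal.ofReal_mul (by positivity), ← mul_pow]
  have h := nabla_smul (Fin.cons c 1) (Fin.cons x N : Fin (k + 1) → EuclideanSpace ℝ (Fin (k + 1)))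
  rw [Fin.prod_univ_succ] at h
  simp only [Fin.cons_zero, Fin.cons_succ, Pi.one_apply, abs_one, Finset.prod_const_one,
    mul_one] at h
  rw [← h]
  congr 3
  ext1 j
  refine Fin.cases ?_ (fun j => ?_) j <;> simp

theorem pinnedMoment_single (p k : ℕ) :
    pinnedMoment p k (EuclideanSpace.single 0 1) =
      ENNReal.ofReal √Real.pi ^ k * detMoment p k := by
  have hn := measurable_nabla (m := k + 1)
  rw [pinnedMoment, lintegral_pi_gauss_eq_gaussMatrix _ (by fun_prop),
    ← lintegral_det_delete_col p 0]
  refine lintegral_congr fun N => ?_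
  rw [nabla_eq_abs_det, Matrix.det_succ_row_zero, Fin.sum_univ_succ]
  simp [Matrix.submatrix]

theorem pinnedMoment_eq (p k : ℕ) (x : EuclideanSpace ℝ (Fin (k + 1))) :
    pinnedMoment p k x =
      ENNReal.ofReal (‖x‖ ^ p) * (ENNReal.ofReal √Real.pi ^ k * detMoment p k) := by
  let v : EuclideanSpace ℝ (Fin (k + 1)) := ‖x‖ • EuclideanSpace.single 0 1
  have hv : ‖v‖ = ‖x‖ := by simp [v, norm_smul]
  -- Reflection in the hyperplane orthogonal to `v - x` carries `v` to `x`, as the norms agree; this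
  -- reduces to a multiple of the first basis vector.
  have h := pinnedMoment_isometry p k (Submodule.reflection (Submodule.span ℝ {v - x})ᗮ) v
  rw [Submodule.reflection_sub hv, pinnedMoment_smul, pinnedMoment_single, abs_norm] at h
  exact h

/-- Integrating the other rows first leaves a function of the first row that depends only on its
norm, by rotation invariance. What remains is the `p`-th moment of that norm times the moment of a
smaller determinant. -/
theorem detMoment_succ (p k : ℕ) :
    detMoment p (k + 1) = ENNReal.ofReal (√Real.pi ^ k * (√Real.pi ^ (k + 1) *
      Real.Gamma ((p + (k + 1 : ℕ) : ℝ) / 2) / Real.Gamma (((k + 1 : ℕ) : ℝ) / 2))) *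
      detMoment p k := by
  have hn := measurable_nabla (m := k + 1)
  have hσ : SigmaFinite (gauss (EuclideanSpace ℝ (Fin (k + 1)))) := inferInstance
  have h := (measurePreserving_piFinSuccAbove
    (fun _ : Fin (k + 1) => gauss (EuclideanSpace ℝ (Fin (k + 1)))) 0).symm
  have hF : Measurable fun u : Fin (k + 1) → EuclideanSpace ℝ (Fin (k + 1)) =>
    ENNReal.ofReal (nabla u ^ p) := by fun_prop
  rw [detMoment_eq_lintegral_nabla, ← h.lintegral_comp hF]
  refine (lintegral_prod _ (hF.comp h.measurable).aemeasurable).trans ?_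
  have : ∀ x : EuclideanSpace ℝ (Fin (k + 1)), (∫⁻ N, ENNReal.ofReal
      (nabla ((MeasurableEquiv.piFinSuccAbove (fun _ => EuclideanSpace ℝ (Fin (k + 1))) 0).symm
        (x, N)) ^ p) ∂(Measure.pi fun _ : Fin k => gauss (EuclideanSpace ℝ (Fin (k + 1))))) =
      pinnedMoment p k x := by
    intro x
    refine lintegral_congr fun N => ?_
    rw [show (MeasurableEquiv.piFinSuccAbove (fun _ => EuclideanSpace ℝ (Fin (k + 1))) 0).symm
      (x, N) = Fin.cons x N from Fin.insertNth_zero' x N]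
  refine (lintegral_congr this).trans ?_
  simp_rw [pinnedMoment_eq]
  rw [lintegral_mul_const _ (by fun_prop), lintegral_norm_pow_gauss (Nat.succ_pos k),
    ENNReal.ofReal_mul (by positivity), ENNReal.ofReal_pow (by positivity)]
  ring

theorem detMoment_eq (p k : ℕ) :
    detMoment p k = ENNReal.ofReal (∏ i ∈ Finset.range k, (√Real.pi ^ i * (√Real.pi ^ (i + 1) *
      Real.Gamma ((p + (i + 1 : ℕ) : ℝ) / 2) / Real.Gamma (((i + 1 : ℕ) : ℝ) / 2)))) := by
  induction k with
  | zero => simp [detMoment_zero]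
  | succ k ih =>
    have h1 : 0 < Real.Gamma (((k + 1 : ℕ) : ℝ) / 2) := Real.Gamma_pos_of_pos (by positivity)
    have h2 : 0 < Real.Gamma ((p + (k + 1 : ℕ) : ℝ) / 2) := Real.Gamma_pos_of_pos (by positivity)
    rw [detMoment_succ, ih, ← ENNReal.ofReal_mul (by positivity), Finset.prod_range_succ, mul_comm]

/-! ### Weighted moments of a linear form in Gaussian variables -/

theorem measurePreserving_neg_gauss : MeasurePreserving (fun x : ℝ => -x) (gauss ℝ) (gauss ℝ) :=
  measurePreserving_gauss_isometry (LinearIsometryEquiv.neg ℝ)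

theorem abs_pow_mul_abs_rpow {p : ℕ} (hp : 1 ≤ p) {r : ℝ} (hr : 0 < r) (x : ℝ) :
    |x| ^ p * |x| ^ (r - 1) = |x| ^ ((p + r) - 1) := by
  rcases eq_or_ne x 0 with rfl | hx
  -- At zero `p ≥ 1` is essential: it makes both sides vanish whatever value `0 ^ (r - 1)` takes.
  · have : (1 : ℝ) ≤ p := by exact_mod_cast hp
    rw [abs_zero, zero_pow (by omega), zero_mul, Real.zero_rpow (by linarith)]
  · rw [← Real.rpow_natCast, ← Real.rpow_add (abs_pos.mpr hx)]
    congr 1; ring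

theorem lintegral_coord_weight {p : ℕ} (hp : 1 ≤ p) {r : ℝ} (hr : 0 < r) {k : ℕ}
    (j : Fin (k + 1)) :
    ∫⁻ h, ENNReal.ofReal (|h j| ^ p * ∏ i, |h i| ^ (r - 1))
      ∂(Measure.pi fun _ : Fin (k + 1) => gauss ℝ) =
      ENNReal.ofReal (Real.Gamma ((p + r) / 2) * Real.Gamma (r / 2) ^ k) := by
  have h1 : ∀ h : Fin (k + 1) → ℝ, ENNReal.ofReal (|h j| ^ p * ∏ i, |h i| ^ (r - 1)) =
      ∏ i, ENNReal.ofReal (|h i| ^ ((if i = j then p + r else r) - 1)) := by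
    intro h
    rw [← ENNReal.ofReal_prod_of_nonneg (fun _ _ => by positivity), Fin.prod_univ_succAbove _ j,
      Fin.prod_univ_succAbove _ j, if_pos rfl, ← mul_assoc, abs_pow_mul_abs_rpow hp hr]
    simp [Fin.succAbove_ne]
  simp_rw [h1]
  rw [lintegral_pi_prod (fun _ => gauss ℝ)
    (fun i x => ENNReal.ofReal (|x| ^ ((if i = j then p + r else r) - 1)))
    (fun i => by fun_prop)]
  have h2 : ∀ i : Fin (k + 1), ∫⁻ x, ENNReal.ofReal (|x| ^ ((if i = j then p + r else r) - 1))
      ∂(gauss ℝ) = ENNReal.ofReal (Real.Gamma ((if i = j then p + r else r) / 2)) := by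
    intro i
    refine lintegral_abs_rpow_gauss ?_
    split_ifs <;> positivity
  have h3 : 0 < Real.Gamma (r / 2) := Real.Gamma_pos_of_pos (by positivity)
  have h4 : 0 < Real.Gamma ((p + r) / 2) := Real.Gamma_pos_of_pos (by positivity)
  simp_rw [h2]
  rw [Fin.prod_univ_succAbove _ j, ENNReal.ofReal_mul h4.le, ENNReal.ofReal_pow h3.le]
  simp [Fin.succAbove_ne]

/-- Convexity of `t ^ p` combined with `2a = (a + b) - (-a + b)`. -/
theorem two_mul_abs_pow_le {p : ℕ} (hp : 1 ≤ p) (a b : ℝ) :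
    2 * |a| ^ p ≤ |a + b| ^ p + |-a + b| ^ p := by
  obtain ⟨q, rfl⟩ := Nat.exists_eq_add_of_le' hp
  have h1 : 2 * |a| ≤ |a + b| + |-a + b| := by
    rw [← abs_two (α := ℝ), ← abs_mul, show (2 : ℝ) * a = (a + b) - (-a + b) by ring]
    exact abs_sub _ _
  have h2 := (pow_le_pow_left₀ (by positivity) h1 (q + 1)).trans
    (add_pow_le (abs_nonneg (a + b)) (abs_nonneg (-a + b)) (q + 1))
  rw [Nat.add_sub_cancel, mul_pow, pow_succ, mul_assoc] at h2
  exact le_of_mul_le_mul_left h2 (by positivity)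

theorem abs_sum_pow_le {p : ℕ} (hp : 1 ≤ p) {k : ℕ} (a : Fin (k + 1) → ℝ) :
    |∑ j, a j| ^ p ≤ (k + 1 : ℝ) ^ (p - 1) * ∑ j, |a j| ^ p := by
  obtain ⟨q, rfl⟩ := Nat.exists_eq_add_of_le' hp
  have h1 := pow_le_pow_left₀ (abs_nonneg _) (Finset.abs_sum_le_sum_abs a Finset.univ) (q + 1)
  have h2 := pow_sum_div_card_le_sum_pow (s := Finset.univ) (f := fun j => |a j|)
    (fun _ _ => abs_nonneg _) q
  rw [div_le_iff₀' (by simp; positivity)] at h2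
  simpa using h1.trans h2

/-- The weight and the Gaussian measure are even in `h 0`, so the integral equals its average with
the sign of `h 0` flipped. `two_mul_abs_pow_le` then discards all other terms pointwise. -/
theorem le_lintegral_abs_sum_pow {p : ℕ} (hp : 1 ≤ p) {r : ℝ} (hr : 0 < r) {k : ℕ}
    (d : Fin (k + 1) → ℝ) :
    ENNReal.ofReal (|d 0| ^ p) *
        ENNReal.ofReal (Real.Gamma ((p + r) / 2) * Real.Gamma (r / 2) ^ k) ≤
      ∫⁻ h, ENNReal.ofReal (|∑ j, h j * d j| ^ p * ∏ i, |h i| ^ (r - 1))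
        ∂(Measure.pi fun _ : Fin (k + 1) => gauss ℝ) := by
  let flip : Fin (k + 1) → ℝ → ℝ := Fin.cons (fun x => -x) fun _ => id
  have hflip : ∀ i, MeasurePreserving (flip i) (gauss ℝ) (gauss ℝ) := by
    refine Fin.cases ?_ fun i => ?_
    · exact measurePreserving_neg_gauss
    · exact MeasurePreserving.id _
  have hpi := measurePreserving_pi _ _ hflip
  have hF : Measurable fun h : Fin (k + 1) → ℝ =>
      ENNReal.ofReal (|∑ j, h j * d j| ^ p * ∏ i, |h i| ^ (r - 1)) := by fun_prop
  have h1 := hpi.lintegral_comp hF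
  have habs : ∀ (h : Fin (k + 1) → ℝ) i, |flip i (h i)| = |h i| := by
    intro h
    refine Fin.cases ?_ fun i => ?_ <;> simp [flip]
  have h2 : 2 * (ENNReal.ofReal (|d 0| ^ p) *
      ∫⁻ h, ENNReal.ofReal (|h 0| ^ p * ∏ i, |h i| ^ (r - 1))
        ∂(Measure.pi fun _ : Fin (k + 1) => gauss ℝ)) ≤
      2 * ∫⁻ h, ENNReal.ofReal (|∑ j, h j * d j| ^ p * ∏ i, |h i| ^ (r - 1))
        ∂(Measure.pi fun _ : Fin (k + 1) => gauss ℝ) := by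
    conv_rhs => rw [two_mul]
    -- Only one of the two copies of the integral receives the sign flip.
    nth_rewrite 2 [← h1]
    rw [← lintegral_add_left hF, ← lintegral_const_mul' _ _ ENNReal.ofReal_ne_top,
      ← lintegral_const_mul' _ _ ENNReal.ofNat_ne_top]
    refine lintegral_mono fun h => ?_
    have hw : 0 ≤ ∏ i, |h i| ^ (r - 1) := by positivity
    simp only [habs]
    rw [← ENNReal.ofReal_mul (by positivity), ← ENNReal.ofReal_add (by positivity) (by positivity),
      ← ENNReal.ofReal_ofNat, ← ENNReal.ofReal_mul (by positivity)]
    refine ENNReal.ofReal_le_ofReal ?_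
    have h3 := two_mul_abs_pow_le hp (h 0 * d 0) (∑ j : Fin k, h j.succ * d j.succ)
    rw [Fin.sum_univ_succ, Fin.sum_univ_succ]
    simp only [flip, Fin.cons_zero, Fin.cons_succ, id_eq, neg_mul]
    rw [abs_mul, mul_pow] at h3
    nlinarith [mul_le_mul_of_nonneg_right h3 hw]
  rw [lintegral_coord_weight hp hr] at h2
  exact (ENNReal.mul_le_mul_iff_right two_ne_zero ENNReal.ofNat_ne_top).mp h2

theorem lintegral_abs_sum_pow_le {p : ℕ} (hp : 1 ≤ p) {r : ℝ} (hr : 0 < r) {k : ℕ}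
    (d : Fin (k + 1) → ℝ) :
    ∫⁻ h, ENNReal.ofReal (|∑ j, h j * d j| ^ p * ∏ i, |h i| ^ (r - 1))
        ∂(Measure.pi fun _ : Fin (k + 1) => gauss ℝ) ≤
      ENNReal.ofReal ((k + 1 : ℝ) ^ (p - 1)) * ((∑ j, ENNReal.ofReal (|d j| ^ p)) *
        ENNReal.ofReal (Real.Gamma ((p + r) / 2) * Real.Gamma (r / 2) ^ k)) := by
  have h1 : ∀ h : Fin (k + 1) → ℝ,
      ENNReal.ofReal (|∑ j, h j * d j| ^ p * ∏ i, |h i| ^ (r - 1)) ≤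
      ENNReal.ofReal ((k + 1 : ℝ) ^ (p - 1)) * ∑ j, ENNReal.ofReal (|d j| ^ p) *
        ENNReal.ofReal (|h j| ^ p * ∏ i, |h i| ^ (r - 1)) := by
    intro h
    have hw : 0 ≤ ∏ i, |h i| ^ (r - 1) := by positivity
    simp only [← ENNReal.ofReal_mul (show 0 ≤ |d _| ^ p by positivity)]
    rw [← ENNReal.ofReal_sum_of_nonneg (fun _ _ => by positivity),
      ← ENNReal.ofReal_mul (by positivity)]
    refine ENNReal.ofReal_le_ofReal
      ((mul_le_mul_of_nonneg_right (abs_sum_pow_le hp fun j => h j * d j) hw).trans_eq ?_)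
    rw [mul_assoc, Finset.sum_mul]
    congr 1
    refine Finset.sum_congr rfl fun j _ => ?_
    rw [abs_mul, mul_pow]; ring
  refine (lintegral_mono h1).trans_eq ?_
  rw [lintegral_const_mul' _ _ ENNReal.ofReal_ne_top, lintegral_finsetSum _ fun j _ => by fun_prop]
  simp only [lintegral_const_mul' _ _ ENNReal.ofReal_ne_top, lintegral_coord_weight hp hr,
    Finset.sum_mul]

/-! ### Two-sided bounds for the Gaussian integral -/

/-- The Gaussian counterpart of the integral over the product of spheres. -/
def gaussIntegral (p k : ℕ) (r : ℝ) : ENNReal :=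
  ∫⁻ M, ENNReal.ofReal (|(Matrix.of M).det| ^ p * ∏ j, |M j (Fin.last k)| ^ (r - 1))
    ∂(gaussMatrix (k + 1) (k + 1))

/-- The cofactors along the last column. -/
def lastCofactor {k : ℕ} (N : Fin (k + 1) → Fin k → ℝ) (j : Fin (k + 1)) : ℝ :=
  (-1) ^ ((j : ℕ) + k) * (Matrix.of fun a => N (j.succAbove a)).det

theorem gaussIntegral_eq (p k : ℕ) (r : ℝ) :
    gaussIntegral p k r = ∫⁻ N, ∫⁻ h, ENNReal.ofReal
      (|∑ j, h j * lastCofactor N j| ^ p * ∏ i, |h i| ^ (r - 1))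
        ∂(Measure.pi fun _ : Fin (k + 1) => gauss ℝ) ∂(gaussMatrix (k + 1) k) := by
  have hm : Measurable fun M : Fin (k + 1) → Fin (k + 1) → ℝ =>
      ENNReal.ofReal (|(Matrix.of M).det| ^ p * ∏ j, |M j (Fin.last k)| ^ (r - 1)) := by
    simp only [Matrix.det_apply, Matrix.of_apply]
    fun_prop
  rw [gaussIntegral, lintegral_gaussMatrix_col (Fin.last k) _ hm]
  refine lintegral_congr fun N => lintegral_congr fun h => ?_
  rw [Matrix.det_succ_column _ (Fin.last k)]
  simp only [Matrix.of_apply, Fin.insertNth_apply_same]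
  congr 4
  refine Finset.sum_congr rfl fun j _ => ?_
  have : (Matrix.of fun a => (Fin.last k).insertNth (α := fun _ => ℝ) (h a) (N a)).submatrix
      j.succAbove (Fin.last k).succAbove = Matrix.of fun a => N (j.succAbove a) := by
    ext a b
    simp only [Matrix.submatrix_apply, Matrix.of_apply, Fin.insertNth_apply_succAbove]
  rw [this, lastCofactor, Fin.val_last]; ring

theorem lintegral_abs_lastCofactor (p : ℕ) {k : ℕ} (j : Fin (k + 1)) :
    ∫⁻ N, ENNReal.ofReal (|lastCofactor N j| ^ p) ∂(gaussMatrix (k + 1) k) =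
      ENNReal.ofReal √Real.pi ^ k * detMoment p k := by
  rw [← lintegral_det_delete_row p j]
  simp [lastCofactor, abs_mul]

theorem measurable_lastCofactor {k p : ℕ} (j : Fin (k + 1)) :
    Measurable fun N : Fin (k + 1) → Fin k → ℝ => ENNReal.ofReal (|lastCofactor N j| ^ p) := by
  simp only [lastCofactor, Matrix.det_apply, Matrix.of_apply]
  fun_prop

theorem le_gaussIntegral {p : ℕ} (hp : 1 ≤ p) {r : ℝ} (hr : 0 < r) (k : ℕ) :
    ENNReal.ofReal √Real.pi ^ k * detMoment p k *
      ENNReal.ofReal (Real.Gamma ((p + r) / 2) * Real.Gamma (r / 2) ^ k) ≤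
      gaussIntegral p k r := by
  rw [gaussIntegral_eq, ← lintegral_abs_lastCofactor p 0,
    ← lintegral_mul_const' _ _ ENNReal.ofReal_ne_top]
  exact lintegral_mono fun N => le_lintegral_abs_sum_pow hp hr (lastCofactor N)

/-- The power mean inequality costs `(k + 1) ^ (p - 1)`; the `k + 1` cofactors, all with the same
moment, supply the last factor. -/
theorem gaussIntegral_le {p : ℕ} (hp : 1 ≤ p) {r : ℝ} (hr : 0 < r) (k : ℕ) :
    gaussIntegral p k r ≤ ENNReal.ofReal ((k + 1 : ℝ) ^ p) *
      (ENNReal.ofReal √Real.pi ^ k * detMoment p k *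
      ENNReal.ofReal (Real.Gamma ((p + r) / 2) * Real.Gamma (r / 2) ^ k)) := by
  rw [gaussIntegral_eq]
  refine (lintegral_mono fun N => lintegral_abs_sum_pow_le hp hr (lastCofactor N)).trans_eq ?_
  rw [lintegral_const_mul' _ _ ENNReal.ofReal_ne_top,
    lintegral_mul_const' _ _ ENNReal.ofReal_ne_top,
    lintegral_finsetSum _ fun j _ => measurable_lastCofactor j]
  simp only [lintegral_abs_lastCofactor, Finset.sum_const, Finset.card_univ, Fintype.card_fin,
    nsmul_eq_mul]
  obtain ⟨q, rfl⟩ := Nat.exists_eq_add_of_le' hp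
  rw [Nat.add_sub_cancel, pow_succ,
    ENNReal.ofReal_mul (p := (k + 1 : ℝ) ^ q) (q := (k : ℝ) + 1) (by positivity),
    show ENNReal.ofReal ((k : ℝ) + 1) = ((k + 1 : ℕ) : ENNReal) by
      rw [← ENNReal.ofReal_natCast]; push_cast; rfl]
  ring

/-! ### Transfer of the bounds to the product of spheres -/

theorem inner_lastBasisVector {k : ℕ} (x : EuclideanSpace ℝ (Fin (k + 1))) :
    inner ℝ x (lastBasisVector (k + 1)) = x (Fin.last k) := by
  have h : ∀ i : Fin (k + 1), (i : ℕ) = k ↔ i = Fin.last k := by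
    intro i; rw [Fin.ext_iff, Fin.val_last]
  simp [lastBasisVector, PiLp.inner_apply, h]

/-- The integrand over the product of spheres, extended to all vectors. -/
def sphereIntegrand (p k : ℕ) (r : ℝ)
    (u : Fin (k + 1) → EuclideanSpace ℝ (Fin (k + 1))) : ℝ :=
  nabla u ^ p * ∏ j, |inner ℝ (u j) (lastBasisVector (k + 1))| ^ (r - 1)

theorem sphereIntegrand_nonneg (p k : ℕ) (r : ℝ)
    (u : Fin (k + 1) → EuclideanSpace ℝ (Fin (k + 1))) : 0 ≤ sphereIntegrand p k r u := by
  have := nabla_nonneg u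
  unfold sphereIntegrand; positivity

theorem measurable_sphereIntegrand (p k : ℕ) (r : ℝ) : Measurable (sphereIntegrand p k r) := by
  have := measurable_nabla (m := k + 1)
  unfold sphereIntegrand
  simp only [inner_lastBasisVector]
  fun_prop

theorem sphereIntegrand_smul (p k : ℕ) (r : ℝ) (c : Fin (k + 1) → ℝ) (hc : ∀ j, 0 < c j)
    (u : Fin (k + 1) → EuclideanSpace ℝ (Fin (k + 1))) :
    sphereIntegrand p k r (fun j => c j • u j) =
      (∏ j, c j ^ (p + r - 1)) * sphereIntegrand p k r u := by
  have h : ∀ j, c j ^ (p + r - 1) = |c j| ^ p * |c j| ^ (r - 1) := by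
    intro j
    rw [abs_of_pos (hc j), ← Real.rpow_natCast, ← Real.rpow_add (hc j)]
    congr 1; ring
  simp only [sphereIntegrand, nabla_smul, real_inner_smul_left, abs_mul, h,
    Real.mul_rpow (abs_nonneg _) (abs_nonneg _), Finset.prod_mul_distrib, mul_pow,
    Finset.prod_pow]
  ring

theorem lintegral_sphereIntegrand {p : ℕ} (hp : 1 ≤ p) {r : ℝ} (hr : 0 < r) (k : ℕ) :
    ENNReal.ofReal (Real.Gamma (((p + k : ℕ) + r) / 2) / 2) ^ (k + 1) *
      ∫⁻ u : Fin (k + 1) → USphere (k + 1), ENNReal.ofReal (sphereIntegrand p k r fun j => u j)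
        ∂(Measure.pi fun _ => surfaceMeasure (k + 1)) = gaussIntegral p k r := by
  have hm := measurable_sphereIntegrand p k r
  have hp' : (1 : ℝ) ≤ p := by exact_mod_cast hp
  have h := lintegral_pi_gauss_of_homogeneous (m := k + 1) (k := k + 1) (Nat.succ_pos k)
    -- The volume contributes degree `p` and the weight `r - 1` in each vector; adding the dimension
    -- `k + 1` gives the Gamma argument `(p + k + r) / 2`.
    (d := p + r - 1)
    (by push_cast; linarith [k.cast_nonneg (α := ℝ)]) (fun u => ENNReal.ofReal (sphereIntegrand p k r u))
    (by fun_prop) (by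
      intro c x hc
      rw [sphereIntegrand_smul p k r c hc, ENNReal.ofReal_mul
        (Finset.prod_nonneg fun j _ => (Real.rpow_nonneg (hc j).le _)),
        ENNReal.ofReal_prod_of_nonneg fun j _ => (Real.rpow_nonneg (hc j).le _)])
  have he : (p + r - 1 + (k + 1 : ℕ) : ℝ) = (p + k : ℕ) + r := by push_cast; ring
  rw [he] at h
  rw [← h, lintegral_pi_gauss_eq_gaussMatrix _ (by fun_prop), gaussIntegral]
  refine lintegral_congr fun M => ?_
  simp only [sphereIntegrand, nabla_eq_abs_det, inner_lastBasisVector]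

/-- The common factor of the two bounds for `gaussIntegral`. -/
def gaussBound (p k : ℕ) (r : ℝ) : ℝ :=
  √Real.pi ^ k * (∏ i ∈ Finset.range k, (√Real.pi ^ i * (√Real.pi ^ (i + 1) *
    Real.Gamma ((p + (i + 1 : ℕ) : ℝ) / 2) / Real.Gamma (((i + 1 : ℕ) : ℝ) / 2)))) *
    (Real.Gamma ((p + r) / 2) * Real.Gamma (r / 2) ^ k)

theorem gaussIntegral_bounds {p : ℕ} (hp : 1 ≤ p) {r : ℝ} (hr : 0 < r) (k : ℕ) :
    ENNReal.ofReal (gaussBound p k r) ≤ gaussIntegral p k r ∧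
      gaussIntegral p k r ≤ ENNReal.ofReal ((k + 1 : ℝ) ^ p * gaussBound p k r) := by
  have h1 := le_gaussIntegral hp hr k
  have h2 := gaussIntegral_le hp hr k
  have hprod : 0 ≤ ∏ i ∈ Finset.range k, (√Real.pi ^ i * (√Real.pi ^ (i + 1) *
      Real.Gamma ((p + (i + 1 : ℕ) : ℝ) / 2) / Real.Gamma (((i + 1 : ℕ) : ℝ) / 2))) := by
    refine Finset.prod_nonneg fun i _ => ?_
    have := Real.Gamma_nonneg_of_nonneg (s := (p + (i + 1 : ℕ) : ℝ) / 2) (by positivity)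
    have := Real.Gamma_nonneg_of_nonneg (s := ((i + 1 : ℕ) : ℝ) / 2) (by positivity)
    positivity
  have hB : ENNReal.ofReal √Real.pi ^ k * detMoment p k *
      ENNReal.ofReal (Real.Gamma ((p + r) / 2) * Real.Gamma (r / 2) ^ k) =
      ENNReal.ofReal (gaussBound p k r) := by
    rw [detMoment_eq, ← ENNReal.ofReal_pow (by positivity), ← ENNReal.ofReal_mul (by positivity),
      ← ENNReal.ofReal_mul (by positivity), gaussBound]
  rw [hB] at h1 h2
  rw [← ENNReal.ofReal_mul (by positivity)] at h2
  exact ⟨h1, h2⟩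

theorem sphereIntegral_bounds {p : ℕ} (hp : 1 ≤ p) {r : ℝ} (hr : 0 < r) (k : ℕ) :
    gaussBound p k r / (Real.Gamma (((p + k : ℕ) + r) / 2) / 2) ^ (k + 1) ≤
        sphereIntegral r (p + k) (k + 1) ∧
      sphereIntegral r (p + k) (k + 1) ≤ (k + 1 : ℝ) ^ p *
        (gaussBound p k r / (Real.Gamma (((p + k : ℕ) + r) / 2) / 2) ^ (k + 1)) := by
  have hG : 0 < Real.Gamma (((p + k : ℕ) + r) / 2) / 2 := by
    have := Real.Gamma_pos_of_pos (s := ((p + k : ℕ) + r) / 2) (by positivity)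
    positivity
  have hGk : 0 < (Real.Gamma (((p + k : ℕ) + r) / 2) / 2) ^ (k + 1) := by positivity
  have hm := measurable_sphereIntegrand p k r
  have hL := lintegral_sphereIntegrand hp hr k
  obtain ⟨h1, h2⟩ := gaussIntegral_bounds hp hr k
  have hS : sphereIntegral r (p + k) (k + 1) =
      (∫⁻ u : Fin (k + 1) → USphere (k + 1), ENNReal.ofReal (sphereIntegrand p k r fun j => u j)
        ∂(Measure.pi fun _ => surfaceMeasure (k + 1))).toReal := by
    have he : p + k - (k + 1) + 1 = p := by omega
    rw [sphereIntegral, he]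
    refine integral_eq_lintegral_of_nonneg_ae
      (ae_of_all _ fun u => sphereIntegrand_nonneg p k r fun j => u j) ?_
    have : Measurable fun u : Fin (k + 1) → USphere (k + 1) =>
      sphereIntegrand p k r fun j => u j := by fun_prop
    exact this.aestronglyMeasurable
  have hB : 0 ≤ gaussBound p k r := by
    unfold gaussBound
    have h3 := Real.Gamma_nonneg_of_nonneg (s := (p + r) / 2) (by positivity)
    have h4 := Real.Gamma_nonneg_of_nonneg (s := r / 2) (by positivity)
    refine mul_nonneg (mul_nonneg (by positivity) (Finset.prod_nonneg fun i _ => ?_))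
      (by positivity)
    have := Real.Gamma_nonneg_of_nonneg (s := (p + (i + 1 : ℕ) : ℝ) / 2) (by positivity)
    have := Real.Gamma_nonneg_of_nonneg (s := ((i + 1 : ℕ) : ℝ) / 2) (by positivity)
    positivity
  -- The upper bound also supplies the finiteness that the lower bound needs, since `toReal` sends
  -- `⊤` to `0`.
  have hfin : gaussIntegral p k r ≠ ⊤ := ne_top_of_le_ne_top ENNReal.ofReal_ne_top h2
  have hLr := congrArg ENNReal.toReal hL
  rw [ENNReal.toReal_mul, ENNReal.toReal_pow, ENNReal.toReal_ofReal hG.le, ← hS] at hLr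
  have h1' := (ENNReal.ofReal_le_iff_le_toReal hfin).mp h1
  have h2' := ENNReal.toReal_le_of_le_ofReal (by positivity) h2
  rw [← hLr] at h1' h2'
  constructor
  · rwa [div_le_iff₀' hGk]
  · rwa [← mul_div_assoc, le_div_iff₀' hGk]

/-! ### Identification of the constants -/

theorem omega_pos {s : ℝ} (hs : 0 < s) : 0 < omega s := by
  have := Real.Gamma_pos_of_pos (half_pos hs)
  unfold omega; positivity

theorem pi_rpow_natCast_add_half (m : ℕ) (s : ℝ) :
    Real.pi ^ ((m + s) / 2) = √Real.pi ^ m * Real.pi ^ (s / 2) := by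
  rw [Real.sqrt_eq_rpow, ← Real.rpow_natCast, ← Real.rpow_mul Real.pi_pos.le,
    ← Real.rpow_add Real.pi_pos]
  congr 1; ring

theorem Gamma_ratio_eq (p : ℕ) {s : ℝ} (hs : 0 < s) :
    Real.Gamma ((p + s) / 2) / Real.Gamma (s / 2) =
      √Real.pi ^ p * (omega s / omega (p + s)) := by
  have h1 := Real.Gamma_pos_of_pos (half_pos hs)
  have h2 := Real.Gamma_pos_of_pos (s := (p + s) / 2) (by positivity)
  rw [omega, omega, pi_rpow_natCast_add_half]
  have : 0 < Real.pi ^ (s / 2) := by positivity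
  field_simp

/-- Each row moment becomes a quotient of `omega` values, arranged so that the products cancel
against those in `constC`. -/
theorem gaussBound_eq (p k : ℕ) (r : ℝ) :
    gaussBound p k r = √Real.pi ^ (k * (p + k + 1)) *
      ((∏ i ∈ Finset.range k, omega ((i + 1 : ℕ) : ℝ)) /
        ∏ i ∈ Finset.range k, omega (p + (i + 1 : ℕ) : ℝ)) *
      (Real.Gamma ((p + r) / 2) * Real.Gamma (r / 2) ^ k) := by
  have h : ∏ i ∈ Finset.range k, (√Real.pi ^ i * (√Real.pi ^ (i + 1) *
      Real.Gamma ((p + (i + 1 : ℕ) : ℝ) / 2) / Real.Gamma (((i + 1 : ℕ) : ℝ) / 2))) =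
      √Real.pi ^ (k * (p + k)) * ((∏ i ∈ Finset.range k, omega ((i + 1 : ℕ) : ℝ)) /
        ∏ i ∈ Finset.range k, omega (p + (i + 1 : ℕ) : ℝ)) := by
    induction k with
    | zero => simp
    | succ k ih =>
      rw [Finset.prod_range_succ, ih, Finset.prod_range_succ, Finset.prod_range_succ,
        mul_div_assoc, Gamma_ratio_eq p (by positivity : (0 : ℝ) < (k + 1 : ℕ)), mul_div_mul_comm]
      ring
  rw [gaussBound, h]
  ring

theorem prod_Icc_omega_one (k : ℕ) : ∏ j ∈ Finset.Icc 1 (k + 1), omega (j : ℝ) =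
    (∏ i ∈ Finset.range k, omega ((i + 1 : ℕ) : ℝ)) * omega ((k + 1 : ℕ) : ℝ) := by
  rw [← Finset.prod_range_succ (fun i : ℕ => omega ((i + 1 : ℕ) : ℝ)),
    Finset.range_eq_Ico, Finset.prod_Ico_add' (fun i : ℕ => omega (i : ℝ))]
  rfl

theorem prod_Icc_omega (p k : ℕ) : ∏ j ∈ Finset.Icc p (p + k), omega (j : ℝ) =
    omega p * ∏ i ∈ Finset.range k, omega (p + (i + 1 : ℕ) : ℝ) := by
  induction k with
  | zero => simp
  | succ k ih =>
    rw [← Nat.add_assoc, Finset.prod_Icc_succ_top (by omega), ih, Finset.prod_range_succ, mul_assoc]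
    push_cast
    ring_nf

theorem boundA_eq {p : ℕ} (hp : 1 ≤ p) {r : ℝ} (hr : 0 < r) (k : ℕ) :
    1 / (r * (Nat.factorial (k + 1) : ℝ)) * (omega (p + k : ℕ) ^ (k + 1))⁻¹ *
      ((∏ j ∈ Finset.Icc p (p + k), omega j) / ∏ j ∈ Finset.Icc 1 (k + 1), omega j) *
      (gaussBound p k r / (Real.Gamma (((p + k : ℕ) + r) / 2) / 2) ^ (k + 1)) =
    boundA (p + k) (k + 1) r := by
  have hp0 : (0 : ℝ) < p := by exact_mod_cast hp
  have h1 : 0 < ∏ i ∈ Finset.range k, omega ((i + 1 : ℕ) : ℝ) :=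
    Finset.prod_pos fun i _ => omega_pos (by positivity)
  have h2 : 0 < ∏ i ∈ Finset.range k, omega (p + (i + 1 : ℕ) : ℝ) :=
    Finset.prod_pos fun i _ => omega_pos (by positivity)
  have hw1 : 0 < omega ((k + 1 : ℕ) : ℝ) := omega_pos (by positivity)
  have hw2 : 0 < omega ((p + k : ℕ) : ℝ) := omega_pos (by positivity)
  have hwp : 0 < omega p := omega_pos hp0
  have hG1 := Real.Gamma_pos_of_pos (half_pos hr)
  have hG2 := Real.Gamma_pos_of_pos (s := (p + r) / 2) (by positivity)
  have hG3 := Real.Gamma_pos_of_pos (s := ((p + k : ℕ) + r) / 2) (by positivity)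
  have hR : 0 < Real.pi ^ (r / 2) := by positivity
  have hq : 0 < √Real.pi := Real.sqrt_pos.mpr Real.pi_pos
  have e1 : ((p + k : ℕ) : ℝ) - (k + 1 : ℕ) + 1 = p := by push_cast; ring
  have e2 : ((p + k : ℕ) : ℝ) - (k + 1 : ℕ) + r + 1 = p + r := by push_cast; ring
  rw [prod_Icc_omega, prod_Icc_omega_one, gaussBound_eq, boundA, e1, e2]
  have hr1 : omega r = 2 * Real.pi ^ (r / 2) / Real.Gamma (r / 2) := rfl
  have hr2 : omega (p + r) =
      2 * (√Real.pi ^ p * Real.pi ^ (r / 2)) / Real.Gamma ((p + r) / 2) := by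
    rw [omega, pi_rpow_natCast_add_half]
  have hr3 : omega ((p + k : ℕ) + r) = 2 * (√Real.pi ^ (p + k) * Real.pi ^ (r / 2)) /
      Real.Gamma (((p + k : ℕ) + r) / 2) := by
    rw [omega, pi_rpow_natCast_add_half]
  rw [hr1, hr2, hr3]
  -- With Gamma values, powers of `π` and `omega` products as independent positive unknowns, only a
  -- rational identity remains.
  generalize Real.Gamma (((p + k : ℕ) + r) / 2) = G3 at *
  generalize Real.Gamma ((p + r) / 2) = G2 at *
  generalize Real.Gamma (r / 2) = G1 at *
  generalize Real.pi ^ (r / 2) = R at *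
  generalize √Real.pi = q at *
  have hf : (0 : ℝ) < (Nat.factorial (k + 1) : ℝ) := by positivity
  generalize (Nat.factorial (k + 1) : ℝ) = f at *
  generalize omega ((p + k : ℕ) : ℝ) = wn at *
  generalize omega ((k + 1 : ℕ) : ℝ) = wl at *
  generalize (∏ i ∈ Finset.range k, omega ((i + 1 : ℕ) : ℝ)) = P1 at *
  generalize (∏ i ∈ Finset.range k, omega (p + (i + 1 : ℕ) : ℝ)) = P2 at *
  simp only [div_pow, mul_pow]
  field_simp
  ring

/-! ### Conclusion -/

theorem constC_bounds {p : ℕ} (hp : 1 ≤ p) {r : ℝ} (hr : 0 < r) (k : ℕ) :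
    boundA (p + k) (k + 1) r ≤ constC r (p + k) (k + 1) ∧
      constC r (p + k) (k + 1) ≤ (k + 1 : ℝ) ^ p * boundA (p + k) (k + 1) r := by
  obtain ⟨h1, h2⟩ := sphereIntegral_bounds hp hr k
  have he : p + k - (k + 1) + 1 = p := by omega
  have hp0 : (0 : ℝ) < p := by exact_mod_cast hp
  rw [← boundA_eq hp hr k, constC, he]
  have hK : 0 ≤ 1 / (r * (Nat.factorial (k + 1) : ℝ)) * (omega (p + k : ℕ) ^ (k + 1))⁻¹ *
      ((∏ j ∈ Finset.Icc p (p + k), omega j) / ∏ j ∈ Finset.Icc 1 (k + 1), omega j) := by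
    have hw2 : 0 < omega ((p + k : ℕ) : ℝ) := omega_pos (by positivity)
    have h3 : 0 ≤ ∏ j ∈ Finset.Icc p (p + k), omega (j : ℝ) :=
      Finset.prod_nonneg fun i hi => (omega_pos (Nat.cast_pos.mpr
        (hp.trans (Finset.mem_Icc.mp hi).1))).le
    have h4 : 0 ≤ ∏ j ∈ Finset.Icc 1 (k + 1), omega (j : ℝ) :=
      Finset.prod_nonneg fun i hi => (omega_pos (Nat.cast_pos.mpr (Finset.mem_Icc.mp hi).1)).le
    exact mul_nonneg (mul_nonneg (by positivity) (inv_nonneg.mpr (pow_nonneg hw2.le _)))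
      (div_nonneg h3 h4)
  refine ⟨mul_le_mul_of_nonneg_left h1 hK, (mul_le_mul_of_nonneg_left h2 hK).trans_eq ?_⟩
  ring

theorem boundA_one {n : ℕ} (hn : 1 ≤ n) {r : ℝ} (hr : 0 < r) : boundA n 1 r = r⁻¹ := by
  have hn0 : (0 : ℝ) < n := by exact_mod_cast hn
  have h1 : omega 1 = 2 := by
    rw [omega, Real.Gamma_one_half_eq, Real.sqrt_eq_rpow]
    field_simp
  have hw1 := omega_pos hr
  have hw2 := omega_pos hn0
  have hw3 : 0 < omega (n + r) := omega_pos (by positivity)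
  have e2 : (n : ℝ) - 1 + r + 1 = n + r := by ring
  simp only [boundA, Nat.cast_one, sub_add_cancel, e2, h1, Nat.factorial_one, pow_one, mul_one]
  field_simp

end PoissonPolyhedra

end

theorem proposition3p4 (n : ℕ) (hn : 1 ≤ n) (r : ℝ) (hr : 0 < r) :
    (∀ ℓ : ℕ, 1 ≤ ℓ → ℓ ≤ n →
      PoissonPolyhedra.boundA n ℓ r ≤ PoissonPolyhedra.constC r n ℓ ∧
      PoissonPolyhedra.constC r n ℓ ≤
        (ℓ : ℝ) ^ (n - ℓ + 1) * PoissonPolyhedra.boundA n ℓ r) ∧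
    PoissonPolyhedra.constC r n 1 = PoissonPolyhedra.boundA n 1 r ∧
    PoissonPolyhedra.boundA n 1 r = r⁻¹ := by
  have h : ∀ ℓ : ℕ, 1 ≤ ℓ → ℓ ≤ n →
      PoissonPolyhedra.boundA n ℓ r ≤ PoissonPolyhedra.constC r n ℓ ∧
      PoissonPolyhedra.constC r n ℓ ≤
        (ℓ : ℝ) ^ (n - ℓ + 1) * PoissonPolyhedra.boundA n ℓ r := by
    intro ℓ h1 h2
    obtain ⟨k, rfl⟩ := Nat.exists_eq_add_of_le' h1
    have hb := PoissonPolyhedra.constC_bounds (p := n - (k + 1) + 1) (by omega) hr k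
    rw [show n - (k + 1) + 1 + k = n by omega] at hb
    rw [Nat.cast_succ]
    exact hb
  refine ⟨h, ?_, PoissonPolyhedra.boundA_one hn hr⟩
  obtain ⟨h1, h2⟩ := h 1 le_rfl hn
  -- For `ℓ = 1` the gap factor is a power of `1`, so the two bounds coincide.
  rw [Nat.cast_one, one_pow, one_mul] at h2
  exact le_antisymm h2 h1
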